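/- Let $\mathcal G=(\mathcal V,\mathcal E,\mathcal W)$ be a finite simple undirected graph with nonzero real edge weights (of either sign), let $W$ be the diagonal matrix of the weights, and fix an arbitrary orientation of the edges. For a graph $\mathcal H$ on $\mathcal V$ let $E(\mathcal H)$ be its oriented incidence matrix (the column of an edge has $1$ at the head, $-1$ at the tail and $0$ elsewhere), and let $L(\mathcal G)=E(\mathcal G)\,W\,E(\mathcal G)^T$ be the weighted Laplacian. Let $\mathcal F\subseteq\mathcal G$ be a spanning forest of $\mathcal G$, that is, an acyclic subgraph on the node set $\mathcal V$ with the same connected components as $\mathcal G$, and let $\mathcal C$ be the graph on $\mathcal V$ whose edges are the edges of $\mathcal G$ that are not in $\mathcal F$. Put $L_e(\mathcal F)=E(\mathcal F)^TE(\mathcal F)$, label the edges of $\mathcal G$ so that those of $\mathcal F$ come first, and put $$R_{(\mathcal F,\mathcal C)}=\begin{bmatrix} I & L_e(\mathcal F)^{-1}E(\mathcal F)^TE(\mathcal C)\end{bmatrix},\qquad L_{ess}(\mathcal F)=L_e(\mathcal F)\,R_{(\mathcal F,\mathcal C)}\,W\,R_{(\mathcal F,\mathcal C)}^T .$$ For a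 square real matrix $A$ that is similar to a real symmetric matrix, let the signature $\sigma(A)=(n_+,n_-,n_0)$ be the numbers of positive, negative and zero eigenvalues of $A$, counted with multiplicity. Then: 1. $L_{ess}(\mathcal F)$ is similar to a real symmetric matrix, $R_{(\mathcal F,\mathcal C)}WR_{(\mathcal F,\mathcal C)}^T$ is symmetric, and $\sigma(L_{ess}(\mathcal F))=\sigma\bigl(R_{(\mathcal F,\mathcal C)}WR_{(\mathcal F,\mathcal C)}^T\bigr)$. 2. If $\mathcal G$ has $c$ connected components and $\sigma(L(\mathcal G))=(n_+,n_-,n_0)$, then $c\le n_0$ and $\sigma\bigl(R_{(\mathcal F,\mathcal C)}WR_{(\mathcal F,\mathcal C)}^T\bigr)=(n_+,n_-,n_0-c)$. 3. The rows of $R_{(\mathcal F,\mathcal C)}$ form a basis of the cut space of $\mathcal G$, that is, of the span in $\mathbb R^{\mathcal E}$ of the signed characteristic vectors of the cuts of $\mathcal G$ (for $S\subseteq\mathcal V$, the vector that is $1$ on the edges entering $S$, $-1$ on the edges leaving $S$, and $0$ elsewhere). -/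

import Mathlib

namespace WeightedLaplacian

open Matrix

noncomputable section

/-- A choice of a tail and a head for every unordered pair of nodes. Restricting it to the edges
orients every graph on `V`, and every orientation of the edges of a graph arises in this way. -/
structure EdgeOrientation (V : Type*) where
  tail : Sym2 V → V
  head : Sym2 V → V
  mk_eq : ∀ e : Sym2 V, s(tail e, head e) = e

variable {V : Type*} [DecidableEq V]

/-- The (oriented) incidence matrix `E(H)`: the column of an edge has `1` at its head, `-1` at its
tail, and `0` elsewhere. -/
def incidence (o : EdgeOrientation V) (H : SimpleGraph V) : Matrix V H.edgeSet ℝ :=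
  Matrix.of fun v e =>
    (if v = o.head (e : Sym2 V) then 1 else 0) - (if v = o.tail (e : Sym2 V) then 1 else 0)

/-- The weighted Laplacian `L(G) = E W Eᵀ`, with `W` the diagonal matrix of the weights. -/
def laplacian (o : EdgeOrientation V) (G : SimpleGraph V) [Fintype G.edgeSet]
    (w : G.edgeSet → ℝ) : Matrix V V ℝ :=
  incidence o G * Matrix.diagonal w * (incidence o G)ᵀ

/-- `F` is a spanning forest of `G`: an acyclic subgraph on all the nodes of `G` that has the same
connected components as `G` (a spanning tree if `G` is connected). -/
structure IsSpanningForest (F G : SimpleGraph V) : Prop where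
  le : F ≤ G
  acyclic : F.IsAcyclic
  reachable : ∀ u v : V, G.Reachable u v → F.Reachable u v

/-- The (unweighted) edge Laplacian `L_e(F) = E(F)ᵀ E(F)`. -/
def edgeLaplacian [Fintype V] (o : EdgeOrientation V) (F : SimpleGraph V) :
    Matrix F.edgeSet F.edgeSet ℝ :=
  (incidence o F)ᵀ * incidence o F

/-- `T_(F,C) = L_e(F)⁻¹ E(F)ᵀ E(C)`, where `C = G \ F` is the cycle subgraph, which has all the
nodes of `G` and those edges of `G` that are not in `F`. -/
def matrixT [Fintype V] (o : EdgeOrientation V) (G F : SimpleGraph V) [Fintype F.edgeSet] :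
    Matrix F.edgeSet (G \ F).edgeSet ℝ :=
  (edgeLaplacian o F)⁻¹ * (incidence o F)ᵀ * incidence o (G \ F)

open Classical in
/-- The labeling of the edges of `G` by the edges of `F` followed by those of `C = G \ F`. -/
def edgeLabeling {F G : SimpleGraph V} (h : F ≤ G) :
    F.edgeSet ⊕ (G \ F).edgeSet ≃ G.edgeSet :=
  ((Equiv.refl _).sumCongr (Equiv.setCongr (SimpleGraph.edgeSet_sdiff G F))).trans
    (Equiv.Set.sumDiffSubset (SimpleGraph.edgeSet_mono h))

/-- `R_(F,C) = [I  T_(F,C)]`, its columns being labeled by the edges of `G`. -/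
def matrixR [Fintype V] (o : EdgeOrientation V) {F G : SimpleGraph V} [Fintype F.edgeSet]
    (h : F ≤ G) : Matrix F.edgeSet G.edgeSet ℝ :=
  Matrix.reindex (Equiv.refl _) (edgeLabeling h) (Matrix.fromCols 1 (matrixT o G F))

/-- `R_(F,C) W R_(F,C)ᵀ`. -/
def matrixRWR [Fintype V] (o : EdgeOrientation V) {F G : SimpleGraph V} [Fintype F.edgeSet]
    [Fintype G.edgeSet] (h : F ≤ G) (w : G.edgeSet → ℝ) : Matrix F.edgeSet F.edgeSet ℝ :=
  matrixR o h * Matrix.diagonal w * (matrixR o h)ᵀ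

/-- The essential edge Laplacian `L_ess(F) = L_e(F) R_(F,C) W R_(F,C)ᵀ`. -/
def essentialEdgeLaplacian [Fintype V] (o : EdgeOrientation V) {F G : SimpleGraph V}
    [Fintype F.edgeSet] [Fintype G.edgeSet] (h : F ≤ G) (w : G.edgeSet → ℝ) :
    Matrix F.edgeSet F.edgeSet ℝ :=
  edgeLaplacian o F * matrixRWR o h w

/-- The numbers of positive, negative and zero real eigenvalues of a square matrix, counted with
algebraic multiplicity. -/
def signature {n : Type*} [Fintype n] [DecidableEq n] (A : Matrix n n ℝ) : ℕ × ℕ × ℕ :=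
  (A.charpoly.roots.countP (fun x => 0 < x),
   A.charpoly.roots.countP (fun x => x < 0),
   A.charpoly.roots.countP (fun x => x = 0))

/-- `A` is similar to a real symmetric matrix (so that all its eigenvalues are real and it is
diagonalizable). -/
def IsSimilarToSymmetric {n : Type*} [Fintype n] [DecidableEq n] (A : Matrix n n ℝ) : Prop :=
  ∃ S B : Matrix n n ℝ, IsUnit S ∧ B.IsSymm ∧ A = S⁻¹ * B * S

/-- The signed characteristic vector of the cut between a set `S` of nodes and its complement:
`1` on the edges that enter `S`, `-1` on those that leave `S`, and `0` elsewhere. -/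
def cutVector (o : EdgeOrientation V) (G : SimpleGraph V) (S : Finset V) : G.edgeSet → ℝ :=
  fun e =>
    if o.head (e : Sym2 V) ∈ S ∧ o.tail (e : Sym2 V) ∉ S then 1
    else if o.tail (e : Sym2 V) ∈ S ∧ o.head (e : Sym2 V) ∉ S then -1
    else 0

/-- The cut space of `G`: the span of the signed characteristic vectors of its cuts. -/
def cutSpace (o : EdgeOrientation V) (G : SimpleGraph V) : Submodule ℝ (G.edgeSet → ℝ) :=
  Submodule.span ℝ (Set.range (cutVector o G))

end

end WeightedLaplacian

namespace WeightedLaplacian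

open Matrix Polynomial

/-! ### Signatures under congruence, products with a positive definite factor, and exchange of
factors. -/

section Inertia

variable {n : Type*} [Fintype n] [DecidableEq n]

/-! Forest paths express every column of `E(G)` through the columns of `E(F)`, and `L_e(F)⁻¹ E(F)ᵀ`
is a left inverse of `E(F)`; hence `E(G) = E(F) R` (`incidence_mul_matrixR`) and `L(G) = E(F) (R W
Rᵀ) E(F)ᵀ`. Moving `E(F)` to the other end leaves `(R W Rᵀ) L_e(F)` and costs `|V| - |E(F)| = c`
zero eigenvalues (`signature_mul_comm_of_card_eq`). The positive definite factor `L_e(F) = Bᵀ B`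
does not affect the signature: `Bᵀ B A` is similar to `B A Bᵀ`, which is congruent to `A`, so
Sylvester's law applies (`signature_posDef_mul`). The same factorization, with `R = L_e(F)⁻¹ E(F)ᵀ
E(G)`, shows that `R` and `E(G)` have the same row space, which is the cut space; the identity block
of `R` makes its rows independent. -/

theorem signature_eq_of_charpoly_eq {A B : Matrix n n ℝ} (h : A.charpoly = B.charpoly) :
    signature A = signature B := by
  simp only [signature, h]

/-- The quadratic form of `S D Sᵀ`, with `D` diagonal and `S` invertible, is equivalent to the
sum of squares weighted by `D`. -/
theorem equivalent_weightedSumSquares_of_eq_mul_diagonal_mul_transpose {A S : Matrix n n ℝ}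
    {d : n → ℝ} (hS : IsUnit S) (h : A = S * diagonal d * Sᵀ) :
    QuadraticMap.Equivalent A.toQuadraticForm' (QuadraticMap.weightedSumSquares ℝ d) := by
  have hdet : IsUnit Sᵀ.det := by
    rw [det_transpose]
    exact (isUnit_iff_isUnit_det S).1 hS
  refine ⟨⟨toLinearEquiv' Sᵀ ((isUnit_iff_isUnit_det _).2 hdet).invertible, fun x => ?_⟩⟩
  have hx : A.toQuadraticForm' x = x ⬝ᵥ A *ᵥ x := toLinearMap₂'_apply' A x x
  have hy : ∀ y, toLinearEquiv' Sᵀ ((isUnit_iff_isUnit_det _).2 hdet).invertible y = Sᵀ *ᵥ y :=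
    fun _ => rfl
  change QuadraticMap.weightedSumSquares ℝ d
    (toLinearEquiv' Sᵀ ((isUnit_iff_isUnit_det _).2 hdet).invertible x) = _
  rw [hx, h, hy, ← mulVec_mulVec, ← mulVec_mulVec, dotProduct_mulVec, ← mulVec_transpose,
    QuadraticMap.weightedSumSquares_apply]
  simp only [dotProduct, mulVec_diagonal, smul_eq_mul]
  exact Finset.sum_congr rfl fun i _ => by ring

theorem exists_eq_mul_diagonal_mul_transpose {A : Matrix n n ℝ} (hA : A.IsHermitian) :
    ∃ S : Matrix n n ℝ, IsUnit S ∧ A = S * diagonal hA.eigenvalues * Sᵀ := by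
  refine ⟨hA.eigenvectorUnitary, (Unitary.toUnits hA.eigenvectorUnitary).isUnit, ?_⟩
  conv_lhs => rw [hA.spectral_theorem, Unitary.conjStarAlgAut_apply]
  rw [star_eq_conjTranspose, conjTranspose_eq_transpose_of_trivial]
  rfl

theorem signature_eq_ncard {A : Matrix n n ℝ} (hA : A.IsHermitian) :
    signature A = ({i | 0 < hA.eigenvalues i}.ncard, {i | hA.eigenvalues i < 0}.ncard,
      {i | hA.eigenvalues i = 0}.ncard) := by
  have key (p : ℝ → Prop) [DecidablePred p] :
      A.charpoly.roots.countP p = {i | p (hA.eigenvalues i)}.ncard := by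
    rw [hA.roots_charpoly_eq_eigenvalues, Multiset.countP_map,
      Set.ncard_eq_toFinset_card' {i | p (hA.eigenvalues i)}]
    simp [Finset.card, Finset.filter]
  simp only [signature, key]

theorem ncard_pos_add_ncard_neg_add_ncard_zero {n : Type*} [Finite n] (d : n → ℝ) :
    {i | 0 < d i}.ncard + {i | d i < 0}.ncard + {i | d i = 0}.ncard = Nat.card n := by
  rw [← Set.ncard_union_eq, ← Set.ncard_union_eq, ← Set.ncard_univ]
  · congr 1
    ext i
    simpa [or_comm, or_left_comm] using (lt_trichotomy (d i) 0)
  · grind [Set.disjoint_iff_forall_ne]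
  · grind [Set.disjoint_iff_forall_ne]

/-- **Sylvester's law of inertia** for congruent symmetric matrices. -/
theorem signature_mul_mul_transpose {A P : Matrix n n ℝ} (hA : A.IsSymm) (hP : IsUnit P) :
    signature (P * A * Pᵀ) = signature A := by
  have hA' : A.IsHermitian := by
    rwa [IsHermitian, conjTranspose_eq_transpose_of_trivial]
  have hB : (P * A * Pᵀ).IsHermitian := by
    rw [IsHermitian, conjTranspose_eq_transpose_of_trivial, transpose_mul, transpose_mul,
      transpose_transpose, hA, Matrix.mul_assoc]
  obtain ⟨S, hS, hAS⟩ := exists_eq_mul_diagonal_mul_transpose hA'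
  obtain ⟨T, hT, hBT⟩ := exists_eq_mul_diagonal_mul_transpose hB
  have hBS : P * A * Pᵀ = (P * S) * diagonal hA'.eigenvalues * (P * S)ᵀ := by
    conv_lhs => rw [hAS]
    simp only [transpose_mul, Matrix.mul_assoc]
  have e₁ := equivalent_weightedSumSquares_of_eq_mul_diagonal_mul_transpose (hP.mul hS) hBS
  have e₂ := equivalent_weightedSumSquares_of_eq_mul_diagonal_mul_transpose hT hBT
  have hpos := (QuadraticForm.sigPos_of_equiv_weightedSumSquares e₁).symm.trans
    (QuadraticForm.sigPos_of_equiv_weightedSumSquares e₂)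
  have hneg := (QuadraticForm.sigNeg_of_equiv_weightedSumSquares e₁).symm.trans
    (QuadraticForm.sigNeg_of_equiv_weightedSumSquares e₂)
  -- The quadratic form determines only the positive and negative counts; the zero count follows
  -- from the total.
  have hcard := (ncard_pos_add_ncard_neg_add_ncard_zero hA'.eigenvalues).trans
    (ncard_pos_add_ncard_neg_add_ncard_zero hB.eigenvalues).symm
  rw [signature_eq_ncard hA', signature_eq_ncard hB]
  simp only [Prod.mk.injEq]
  omega

open scoped MatrixOrder Matrix.Norms.L2Operator in
theorem exists_isUnit_eq_transpose_mul_self {L : Matrix n n ℝ} (hL : L.PosDef) :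
    ∃ B : Matrix n n ℝ, IsUnit B ∧ L = Bᵀ * B := by
  obtain ⟨B, hB⟩ := CStarAlgebra.nonneg_iff_eq_star_mul_self.mp hL.posSemidef.nonneg
  rw [star_eq_conjTranspose, conjTranspose_eq_transpose_of_trivial] at hB
  refine ⟨B, ?_, hB⟩
  have := (isUnit_iff_isUnit_det _).1 hL.isUnit
  rw [hB, det_mul] at this
  exact (isUnit_iff_isUnit_det _).2 (isUnit_of_mul_isUnit_right this)

/-- The double inverse matches the shape `S⁻¹ * _ * S` of `IsSimilarToSymmetric`, with `S = (Bᵀ)⁻¹`.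
-/
theorem transpose_mul_self_mul_eq_conj (A : Matrix n n ℝ) {B : Matrix n n ℝ} (hB : IsUnit B) :
    Bᵀ * B * A = ((Bᵀ)⁻¹)⁻¹ * (B * A * Bᵀ) * (Bᵀ)⁻¹ := by
  have hdet : IsUnit Bᵀ.det := by
    rw [det_transpose]
    exact (isUnit_iff_isUnit_det B).1 hB
  rw [nonsing_inv_nonsing_inv _ hdet]
  simp only [Matrix.mul_assoc]
  rw [mul_nonsing_inv _ hdet, Matrix.mul_one]

theorem isSimilarToSymmetric_posDef_mul {L A : Matrix n n ℝ} (hL : L.PosDef) (hA : A.IsSymm) :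
    IsSimilarToSymmetric (L * A) := by
  obtain ⟨B, hB, rfl⟩ := exists_isUnit_eq_transpose_mul_self hL
  refine ⟨(Bᵀ)⁻¹, B * A * Bᵀ, ?_, ?_, transpose_mul_self_mul_eq_conj A hB⟩
  · rw [isUnit_nonsing_inv_iff]
    exact (isUnit_transpose B).2 hB
  · rw [IsSymm, transpose_mul, transpose_mul, transpose_transpose, hA, Matrix.mul_assoc]

theorem signature_posDef_mul {L A : Matrix n n ℝ} (hL : L.PosDef) (hA : A.IsSymm) :
    signature (L * A) = signature A := by
  obtain ⟨B, hB, rfl⟩ := exists_isUnit_eq_transpose_mul_self hL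
  rw [← signature_mul_mul_transpose hA hB]
  apply signature_eq_of_charpoly_eq
  rw [Matrix.mul_assoc, charpoly_mul_comm]

/-- Exchanging the factors of a product of rectangular matrices only adds zero eigenvalues. -/
theorem signature_mul_comm_of_card_eq {m : Type*} [Fintype m] [DecidableEq m]
    (A : Matrix m n ℝ) (B : Matrix n m ℝ) {c : ℕ} (hc : Fintype.card m = Fintype.card n + c) :
    signature (A * B) = signature (B * A) + (0, 0, c) := by
  have h := charpoly_mul_comm_of_le A B (by omega)
  rw [hc, Nat.add_sub_cancel_left] at h
  have hroots : (A * B).charpoly.roots = c • {0} + (B * A).charpoly.roots := by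
    rw [h, roots_mul, roots_X_pow]
    exact mul_ne_zero (pow_ne_zero _ X_ne_zero) (charpoly_monic _).ne_zero
  have hzero (p : ℝ → Prop) [DecidablePred p] :
      Multiset.countP p {0} = if p 0 then 1 else 0 := by
    rw [← Multiset.cons_zero, Multiset.countP_cons, Multiset.countP_zero, zero_add]
  simp [signature, hroots, Multiset.countP_nsmul, hzero, add_comm]

end Inertia

/-! ### Incidence matrices, forests and cuts. -/

section Incidence

theorem adj_tail_head {V : Type*} (o : EdgeOrientation V) {H : SimpleGraph V} (e : H.edgeSet) :
    H.Adj (o.tail e) (o.head e) := by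
  rw [← SimpleGraph.mem_edgeSet, o.mk_eq]
  exact e.2

variable {V : Type*} [DecidableEq V] (o : EdgeOrientation V)

theorem vecMul_incidence [Fintype V] (H : SimpleGraph V) (x : V → ℝ) (e : H.edgeSet) :
    (x ᵥ* incidence o H) e = x (o.head e) - x (o.tail e) := by
  simp [vecMul, dotProduct, incidence, mul_sub]

theorem eq_of_reachable_of_vecMul_incidence_eq_zero [Fintype V] {H : SimpleGraph V} {x : V → ℝ}
    (hx : x ᵥ* incidence o H = 0) {u v : V} (h : H.Reachable u v) : x u = x v := by
  obtain ⟨p⟩ := h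
  induction p with
  | nil => rfl
  | @cons a b _ hab _ ih =>
    rw [← ih]
    have h := congrFun hx ⟨s(a, b), hab⟩
    rw [vecMul_incidence, Pi.zero_apply, sub_eq_zero] at h
    -- The walk may traverse the edge along or against its orientation.
    rcases Sym2.eq_iff.1 (o.mk_eq s(a, b)) with ⟨h₁, h₂⟩ | ⟨h₁, h₂⟩
    · rw [h₁, h₂] at h
      exact h.symm
    · rw [h₁, h₂] at h
      exact h

/-- Every edge of a forest is a bridge, so its incidence matrix has a left inverse: a row is the
characteristic vector of the nodes on the head side of an edge. -/
theorem exists_mul_incidence_eq_one [Fintype V] {F : SimpleGraph V} (hF : F.IsAcyclic) :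
    ∃ Q : Matrix F.edgeSet V ℝ, Q * incidence o F = 1 := by
  classical
  refine ⟨of fun e v => if (F.deleteEdges {(e : Sym2 V)}).Reachable (o.head e) v then 1 else 0, ?_⟩
  ext e f
  have hrow := vecMul_incidence o F
    (fun v => if (F.deleteEdges {(e : Sym2 V)}).Reachable (o.head e) v then (1 : ℝ) else 0) f
  refine Eq.trans hrow ?_
  rcases eq_or_ne e f with rfl | hne
  · have hb := SimpleGraph.isAcyclic_iff_forall_isBridge.1 hF e.2
    rw [← o.mk_eq e, SimpleGraph.isBridge_iff, o.mk_eq e, SimpleGraph.reachable_comm] at hb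
    simp [hb]
  · have hadj : (F.deleteEdges {(e : Sym2 V)}).Adj (o.tail f) (o.head f) := by
      rw [SimpleGraph.deleteEdges_adj, o.mk_eq]
      exact ⟨adj_tail_head o f, fun h => hne (Subtype.ext h.symm)⟩
    have : (F.deleteEdges {(e : Sym2 V)}).Reachable (o.head e) (o.head f) ↔
        (F.deleteEdges {(e : Sym2 V)}).Reachable (o.head e) (o.tail f) :=
      ⟨fun h => h.trans hadj.reachable.symm, fun h => h.trans hadj.reachable⟩
    simp [this, one_apply_ne hne]

/-- The signed edge columns telescope along a walk from `u` to `v`. -/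
theorem exists_incidence_mulVec_eq_single_sub_single {F : SimpleGraph V} [Fintype F.edgeSet]
    {u v : V} (h : F.Reachable u v) :
    ∃ x, incidence o F *ᵥ x = Pi.single v 1 - Pi.single u 1 := by
  obtain ⟨p⟩ := h
  induction p with
  | nil => exact ⟨0, by simp⟩
  | @cons a b c hab _ ih =>
    obtain ⟨x, hx⟩ := ih
    have hcol : incidence o F *ᵥ Pi.single ⟨s(a, b), hab⟩ 1 =
        Pi.single (o.head s(a, b)) 1 - Pi.single (o.tail s(a, b)) 1 := by
      ext i
      simp [incidence, Pi.single_apply]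
    rcases Sym2.eq_iff.1 (o.mk_eq s(a, b)) with ⟨h₁, h₂⟩ | ⟨h₁, h₂⟩
    · refine ⟨x + Pi.single ⟨s(a, b), hab⟩ 1, ?_⟩
      rw [mulVec_add, hx, hcol, h₁, h₂]
      abel
    · refine ⟨x - Pi.single ⟨s(a, b), hab⟩ 1, ?_⟩
      rw [mulVec_sub, hx, hcol, h₁, h₂]
      abel

theorem exists_incidence_eq_mul {F G : SimpleGraph V} [Fintype F.edgeSet]
    (hF : IsSpanningForest F G) :
    ∃ X : Matrix F.edgeSet G.edgeSet ℝ, incidence o G = incidence o F * X := by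
  choose x hx using fun e : G.edgeSet => exists_incidence_mulVec_eq_single_sub_single o
    (hF.reachable _ _ (adj_tail_head o e).reachable)
  refine ⟨of fun f e => x e f, ?_⟩
  ext v e
  have h := congrFun (hx e) v
  rw [mul_apply_eq_vecMul]
  simp only [incidence, of_apply]
  refine Eq.trans ?_ h.symm
  simp [Pi.single_apply]

/-- In the sum, the contributions of an edge with both ends in `S` cancel. -/
theorem cutVector_eq_sum (G : SimpleGraph V) (S : Finset V) :
    cutVector o G S = ∑ v ∈ S, (incidence o G).row v := by
  ext e
  have h : (∑ v ∈ S, (incidence o G).row v) e =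
      (if o.head e ∈ S then 1 else 0) - (if o.tail e ∈ S then 1 else 0) := by
    rw [Finset.sum_apply]
    simp [row_apply, incidence]
  rw [h, cutVector]
  split_ifs <;> simp_all

theorem cutSpace_eq_span_row [Fintype V] (G : SimpleGraph V) :
    cutSpace o G = Submodule.span ℝ (Set.range (incidence o G).row) := by
  refine le_antisymm (Submodule.span_le.2 ?_) (Submodule.span_le.2 ?_)
  · rintro _ ⟨S, rfl⟩
    rw [cutVector_eq_sum]
    exact Submodule.sum_mem _ fun v _ => Submodule.subset_span ⟨v, rfl⟩
  · rintro _ ⟨v, rfl⟩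
    exact Submodule.subset_span ⟨{v}, by rw [cutVector_eq_sum, Finset.sum_singleton]⟩

theorem span_row_mul_le {l m n : Type*} [Fintype m] (A : Matrix l m ℝ) (B : Matrix m n ℝ) :
    Submodule.span ℝ (Set.range (A * B).row) ≤ Submodule.span ℝ (Set.range B.row) := by
  rw [Submodule.span_le]
  rintro _ ⟨i, rfl⟩
  have h : (A * B).row i = ∑ j, A i j • B.row j := by
    ext k
    simp [row, mul_apply]
  rw [h]
  exact Submodule.sum_mem _ fun j _ => Submodule.smul_mem _ _ (Submodule.subset_span ⟨j, rfl⟩)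

end Incidence

/-! ### The matrix `R` of a spanning forest. -/

section SpanningForest

variable {V : Type*} [Fintype V] [DecidableEq V] (o : EdgeOrientation V) {F G : SimpleGraph V}
  [Fintype F.edgeSet]

theorem posDef_edgeLaplacian (hF : F.IsAcyclic) : (edgeLaplacian o F).PosDef := by
  obtain ⟨Q, hQ⟩ := exists_mul_incidence_eq_one o hF
  rw [edgeLaplacian, ← conjTranspose_eq_transpose_of_trivial]
  refine PosDef.conjTranspose_mul_self _ fun x y hxy => ?_
  simpa [mulVec_mulVec, hQ] using congrArg (Q *ᵥ ·) hxy

theorem isUnit_det_edgeLaplacian (hF : F.IsAcyclic) : IsUnit (edgeLaplacian o F).det :=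
  (isUnit_iff_isUnit_det _).1 (posDef_edgeLaplacian o hF).isUnit

theorem matrixR_eq (hF : IsSpanningForest F G) :
    matrixR o hF.le = (edgeLaplacian o F)⁻¹ * (incidence o F)ᵀ * incidence o G := by
  ext f e
  obtain ⟨e, rfl⟩ := (edgeLabeling hF.le).surjective e
  simp only [matrixR, reindex_apply, submatrix_apply, Equiv.refl_symm, Equiv.refl_apply,
    Equiv.symm_apply_apply]
  rcases e with e | e
  · have h : (edgeLaplacian o F)⁻¹ * (incidence o F)ᵀ * incidence o F = 1 := by
      rw [Matrix.mul_assoc]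
      exact nonsing_inv_mul _ (isUnit_det_edgeLaplacian o hF.acyclic)
    rw [fromCols_apply_inl, ← h]
    rfl
  · rfl

/-- `E(F) L_e(F)⁻¹ E(F)ᵀ` is the projection onto the column space of `E(F)`, so it fixes `E(G) =
E(F) X`. -/
theorem incidence_mul_matrixR (hF : IsSpanningForest F G) :
    incidence o F * matrixR o hF.le = incidence o G := by
  obtain ⟨X, hX⟩ := exists_incidence_eq_mul o hF
  have h : (edgeLaplacian o F)⁻¹ * ((incidence o F)ᵀ * incidence o F) = 1 :=
    nonsing_inv_mul _ (isUnit_det_edgeLaplacian o hF.acyclic)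
  rw [matrixR_eq o hF, hX, Matrix.mul_assoc _ (incidence o F)ᵀ, ← Matrix.mul_assoc (incidence o F)ᵀ,
    ← Matrix.mul_assoc _ (_ * _) X, h, Matrix.one_mul]

/-- Rank-nullity for `x ↦ x E(F)`: it is onto by the left inverse `Q`, and its kernel, the functions
constant on components, is that of the unweighted Laplacian of `G`, whose dimension counts the
components. -/
theorem card_eq_card_edgeSet_add_card_connectedComponent (o : EdgeOrientation V)
    [DecidableRel G.Adj] (hF : IsSpanningForest F G) :
    Fintype.card V = Fintype.card F.edgeSet + Nat.card G.ConnectedComponent := by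
  obtain ⟨Q, hQ⟩ := exists_mul_incidence_eq_one o hF.acyclic
  have hker : LinearMap.ker (incidence o F).vecMulLinear =
      LinearMap.ker (Matrix.toLin' (G.lapMatrix ℝ)) := by
    ext x
    rw [LinearMap.mem_ker, LinearMap.mem_ker, toLin'_apply, vecMulLinear_apply,
      SimpleGraph.lapMatrix_mulVec_eq_zero_iff_forall_reachable]
    refine ⟨fun h i j hij =>
      eq_of_reachable_of_vecMul_incidence_eq_zero o h (hF.reachable i j hij), fun h => ?_⟩
    ext e
    rw [vecMul_incidence, h _ _ (hF.le (adj_tail_head o e)).reachable]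
    simp
  have hrange : LinearMap.range (incidence o F).vecMulLinear = ⊤ :=
    LinearMap.range_eq_top.2 fun y => ⟨y ᵥ* Q, by simp [hQ]⟩
  have h := LinearMap.finrank_range_add_finrank_ker (incidence o F).vecMulLinear
  rw [hrange, hker, finrank_top, Module.finrank_fintype_fun_eq_card,
    Module.finrank_fintype_fun_eq_card] at h
  classical
  rw [← h, Nat.card_eq_fintype_card,
    SimpleGraph.card_connectedComponent_eq_finrank_ker_toLin'_lapMatrix]

theorem isSymm_matrixRWR [Fintype G.edgeSet] (h : F ≤ G) (w : G.edgeSet → ℝ) :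
    (matrixRWR o h w).IsSymm := by
  simp [matrixRWR, IsSymm, transpose_mul, Matrix.mul_assoc]

theorem laplacian_eq [Fintype G.edgeSet] (hF : IsSpanningForest F G) (w : G.edgeSet → ℝ) :
    laplacian o G w = incidence o F * (matrixRWR o hF.le w * (incidence o F)ᵀ) := by
  rw [laplacian, ← incidence_mul_matrixR o hF]
  simp only [matrixRWR, transpose_mul, Matrix.mul_assoc]

theorem signature_laplacian [Fintype G.edgeSet] [DecidableRel G.Adj] (hF : IsSpanningForest F G)
    (w : G.edgeSet → ℝ) :
    signature (laplacian o G w) =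
      signature (matrixRWR o hF.le w) + (0, 0, Nat.card G.ConnectedComponent) := by
  rw [laplacian_eq o hF, signature_mul_comm_of_card_eq _ _
    (card_eq_card_edgeSet_add_card_connectedComponent o hF),
    ← signature_posDef_mul (posDef_edgeLaplacian o hF.acyclic) (isSymm_matrixRWR o hF.le w)]
  congr 1
  apply signature_eq_of_charpoly_eq
  rw [Matrix.mul_assoc, charpoly_mul_comm]
  rfl

theorem linearIndependent_row_matrixR (hF : IsSpanningForest F G) :
    LinearIndependent ℝ (matrixR o hF.le).row := by
  rw [Fintype.linearIndependent_iff]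
  intro g hg f
  -- At the column of the forest edge `f`, the identity block isolates the coefficient `g f`.
  have h := congrFun hg (edgeLabeling hF.le (Sum.inl f))
  simpa [matrixR, row, one_apply] using h

theorem span_row_matrixR (hF : IsSpanningForest F G) :
    Submodule.span ℝ (Set.range (matrixR o hF.le).row) = cutSpace o G := by
  rw [cutSpace_eq_span_row]
  apply le_antisymm
  · rw [matrixR_eq o hF]
    exact span_row_mul_le _ _
  · rw [← incidence_mul_matrixR o hF]
    exact span_row_mul_le _ _

end SpanningForest

end WeightedLaplacian

open WeightedLaplacian in
theorem mainTheorem4 {V : Type*} [Fintype V] [DecidableEq V]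
    (G : SimpleGraph V) [DecidableRel G.Adj] (o : EdgeOrientation V)
    (w : G.edgeSet → ℝ) (hw : ∀ e, w e ≠ 0)
    (F : SimpleGraph V) [DecidableRel F.Adj] (hF : IsSpanningForest F G) :
    -- the signature of the essential edge Laplacian is meaningful ...
    IsSimilarToSymmetric (essentialEdgeLaplacian o hF.le w) ∧
    -- ... and it is the signature of the symmetric matrix `R W Rᵀ`
    (matrixRWR o hF.le w).IsSymm ∧
    signature (essentialEdgeLaplacian o hF.le w) = signature (matrixRWR o hF.le w) ∧
    -- the signature of `R W Rᵀ` in terms of that of the weighted Laplacian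
    (∀ c np nm n0 : ℕ, Nat.card G.ConnectedComponent = c →
      signature (laplacian o G w) = (np, nm, n0) →
      c ≤ n0 ∧ signature (matrixRWR o hF.le w) = (np, nm, n0 - c)) ∧
    -- the rows of `R` form a basis of the cut space
    LinearIndependent ℝ (matrixR o hF.le).row ∧
    Submodule.span ℝ (Set.range (matrixR o hF.le).row) = cutSpace o G := by
  have hL := posDef_edgeLaplacian o hF.acyclic
  have hM := isSymm_matrixRWR o hF.le w
  refine ⟨isSimilarToSymmetric_posDef_mul hL hM, hM, signature_posDef_mul hL hM, ?_,
    linearIndependent_row_matrixR o hF, span_row_matrixR o hF⟩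
  rintro _ np nm n0 rfl h
  rw [signature_laplacian o hF] at h
  generalize signature (matrixRWR o hF.le w) = σ at h ⊢
  obtain ⟨a, b, c⟩ := σ
  simp only [Prod.mk_add_mk, Prod.mk.injEq, add_zero] at h ⊢
  omega
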